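/- Let $n\ge 2$ with $n\equiv 1$ or $9 \pmod{12}$, and let $\mathcal{B}$ be a Steiner triple system on $\{1,\dots,n\}$, i.e. a collection of three-element subsets (blocks) such that every pair of distinct points is contained in exactly one block. Let $$P_{\mathcal{B}}(x)=\sum_{\{a,b,c\}\in\mathcal{B}}x_ax_bx_c,\qquad P_n(x)=\frac{\sqrt{n(n+1)}}{6}\sum_{j=2}^{n}\frac{1}{\sqrt{j(j+1)}}\sum_{i=1}^{j-1}\left(x_j^3-3x_jx_i^2\right)$$ be, respectively, the cubic polynomial of $\mathcal{B}$ and the simplicial polynomial on Euclidean $\mathbb{R}^n$. Then: (1) $P_{\mathcal{B}}$ is not conformally linearly equivalent to $P_n$: there is no $g=rA$ with $0\ne r\in\mathbb{R}$ and $A\in O(n)$ such that $P_{\mathcal{B}}(g^{-1}x)=P_n(x)$ for all $x\in\mathbb{R}^n$; (2) $P_{\mathcal{B}}$ is not conformally associative: for $P=P_{\mathcal{B}}$, the tensor $$A_{ijkl}+\tfrac{1}{n-2}\left(\delta_{ki}R_{jl}-\delta_{kj}R_{il}-\delta_{li}R_{jk}+\delta_{lj}R_{ik}\right)-\tfrac{S}{(n-1)(n-2)}\left(\delta_{ki}\delta_{jl}-\delta_{kj}\delta_{il}\right)$$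 is not identically zero, where $P_{ijk}=\partial_i\partial_j\partial_kP$, $A_{ijkl}=\sum_p\left(P_{lip}P_{jkp}-P_{ljp}P_{ikp}\right)$, $R_{ij}=\sum_pA_{pijp}$ and $S=\sum_pR_{pp}$. -/

import Mathlib

open MvPolynomial

noncomputable section

/-- A Steiner triple system on the point set `Fin n`: a collection of three-element blocks such
that every pair of distinct points lies in exactly one block. -/
structure IsSteinerTripleSystem {n : ℕ} (B : Finset (Finset (Fin n))) : Prop where
  card_block : ∀ b ∈ B, b.card = 3
  existsUnique_block : ∀ i j : Fin n, i ≠ j → ∃! b, b ∈ B ∧ i ∈ b ∧ j ∈ b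

/-- The cubic polynomial `P_B = ∑_{abc ∈ B} x_a x_b x_c` on `ℝⁿ`. -/
def steinerCubic {n : ℕ} (B : Finset (Finset (Fin n))) : MvPolynomial (Fin n) ℝ :=
  ∑ b ∈ B, ∏ a ∈ b, X a

/-- The simplicial polynomial
`P_n = (√(n(n+1)) / 6) ∑_{j=2}^n (1 / √(j(j+1))) ∑_{i=1}^{j-1} (x_j³ - 3 x_j x_i²)` on `ℝⁿ`.
The coordinate `x_j` (`1 ≤ j ≤ n`) is `X ⟨j - 1, _⟩`, so that `j : Fin n` below stands for the index
`j + 1`; the first summand (`j = 0`) has an empty inner sum. -/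
def simplicialPoly (n : ℕ) : MvPolynomial (Fin n) ℝ :=
  C (√((n : ℝ) * ((n : ℝ) + 1)) / 6) *
    ∑ j : Fin n, C (1 / √(((j : ℕ) + 1 : ℝ) * ((j : ℕ) + 2 : ℝ))) *
      ∑ i ∈ Finset.Iio j, (X j ^ 3 - 3 * X j * X i ^ 2)

/-- The group `CO(n)` of conformal linear transformations of Euclidean `ℝⁿ`: the invertible
matrices of the form `r A` with `r` a nonzero real number and `A` an orthogonal matrix. -/
def conformalLinearGroup (n : ℕ) : Subgroup (GL (Fin n) ℝ) where
  carrier := {g | ∃ r : ℝ, r ≠ 0 ∧ ∃ A ∈ Matrix.orthogonalGroup (Fin n) ℝ,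
    (g : Matrix (Fin n) (Fin n) ℝ) = r • A}
  one_mem' := ⟨1, one_ne_zero, 1, one_mem _, by simp⟩
  mul_mem' := by
    rintro g h ⟨r, hr, A, hA, hg⟩ ⟨s, hs, B, hB, hh⟩
    refine ⟨r * s, mul_ne_zero hr hs, A * B, mul_mem hA hB, ?_⟩
    rw [Units.val_mul, hg, hh, Matrix.smul_mul, Matrix.mul_smul, smul_smul]
  inv_mem' := by
    rintro g ⟨r, hr, A, hA, hg⟩
    refine ⟨r⁻¹, inv_ne_zero hr, star A, Unitary.star_mem hA, ?_⟩
    refine Units.inv_eq_of_mul_eq_one_right ?_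
    rw [hg, Matrix.smul_mul, Matrix.mul_smul, smul_smul, mul_inv_cancel₀ hr, one_smul]
    exact (Matrix.mem_orthogonalGroup_iff _ _).1 hA

/-- The left action of `GL(n, ℝ)` on polynomials, `(g · P)(x) = P(g⁻¹ x)`. -/
def glAct {n : ℕ} (g : GL (Fin n) ℝ) (P : MvPolynomial (Fin n) ℝ) : MvPolynomial (Fin n) ℝ :=
  aeval (fun i => ∑ j, C ((g⁻¹ : GL (Fin n) ℝ).val i j) * X j) P

/-- As a function on `ℝⁿ`, `g · P` is `x ↦ P(g⁻¹ x)`. -/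
theorem eval_glAct {n : ℕ} (g : GL (Fin n) ℝ) (P : MvPolynomial (Fin n) ℝ) (x : Fin n → ℝ) :
    eval x (glAct g P) = eval (((g⁻¹ : GL (Fin n) ℝ).val).mulVec x) P := by
  unfold glAct
  induction P using MvPolynomial.induction_on with
  | C a => simp
  | add p q hp hq => simp only [map_add, hp, hq]
  | mul_X p i hp =>
    rw [map_mul, map_mul, map_mul, hp, aeval_X, eval_X]
    simp [Matrix.mulVec, dotProduct]

/-- Conformal linear equivalence: `P` and `Q` lie on the same orbit of `CO(n)`. -/
def ConformallyEquivalent {n : ℕ} (P Q : MvPolynomial (Fin n) ℝ) : Prop :=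
  ∃ g ∈ conformalLinearGroup n, glAct g P = Q

/-- The components `F_{ijk}` of the third derivative of `F` in the standard orthonormal
coordinates. -/
def thirdDeriv {n : ℕ} (F : MvPolynomial (Fin n) ℝ) (i j k : Fin n) : MvPolynomial (Fin n) ℝ :=
  pderiv i (pderiv j (pderiv k F))

/-- The components `h_{ij}` of the Euclidean metric. -/
def euclideanMetric {n : ℕ} (i j : Fin n) : MvPolynomial (Fin n) ℝ := if i = j then 1 else 0

/-- The nonassociativity tensor
`𝒜(F)_{ijkl} = 2 F_{l[i}^p F_{j]kp} = ∑ₚ (F_{lip} F_{jkp} - F_{ljp} F_{ikp})`. -/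
def nonassociativity {n : ℕ} (F : MvPolynomial (Fin n) ℝ) (i j k l : Fin n) :
    MvPolynomial (Fin n) ℝ :=
  ∑ p, (thirdDeriv F l i p * thirdDeriv F j k p - thirdDeriv F l j p * thirdDeriv F i k p)

/-- The Ricci-type trace `ρ_{ij} = 𝒜(F)_{pij}^p`. -/
def nonassociativityRicci {n : ℕ} (F : MvPolynomial (Fin n) ℝ) (i j : Fin n) :
    MvPolynomial (Fin n) ℝ :=
  ∑ p, nonassociativity F p i j p

/-- The scalar trace `σ = ρ_p^p`. -/
def nonassociativityScalar {n : ℕ} (F : MvPolynomial (Fin n) ℝ) : MvPolynomial (Fin n) ℝ :=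
  ∑ p, nonassociativityRicci F p p

/-- The conformal nonassociativity tensor (meaningful for `n ≥ 3`)
`𝒜(F)_{ijkl} + (2/(n-2)) (h_{k[i} ρ_{j]l} - h_{l[i} ρ_{j]k}) - (2/((n-1)(n-2))) σ h_{k[i} h_{j]l}`,
where `2 T_{[ij]} = T_{ij} - T_{ji}`. -/
def conformalNonassociativity {n : ℕ} (F : MvPolynomial (Fin n) ℝ) (i j k l : Fin n) :
    MvPolynomial (Fin n) ℝ :=
  nonassociativity F i j k l
    + C (1 / ((n : ℝ) - 2)) *
      ((euclideanMetric k i * nonassociativityRicci F j l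
          - euclideanMetric k j * nonassociativityRicci F i l)
        - (euclideanMetric l i * nonassociativityRicci F j k
          - euclideanMetric l j * nonassociativityRicci F i k))
    - C (1 / (((n : ℝ) - 1) * ((n : ℝ) - 2))) * nonassociativityScalar F *
      (euclideanMetric k i * euclideanMetric j l - euclideanMetric k j * euclideanMetric i l)

/-- `P` is conformally associative if its conformal nonassociativity tensor vanishes. -/
def ConformallyAssociative {n : ℕ} (P : MvPolynomial (Fin n) ℝ) : Prop :=
  ∀ i j k l : Fin n, conformalNonassociativity P i j k l = 0

end

/-!
A polynomial `P` makes `ℝⁿ` a commutative algebra by `⟨x ∘ y, z⟩ = D³P(x, y, z)`. The identity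
`⟨a ∘ b, c ∘ d⟩ = ⟨a ∘ c, b ∘ d⟩`, required when `a`, `d` are orthogonal to `b`, `c`, is invariant
under conformal linear maps. It holds for the simplicial polynomial, which is a multiple of the sum
of the cubes of the `n + 1` linear forms given by the vertices of a regular simplex: both sides are
then the same quartic sum over the vertices. Conformal associativity gives it on the standard basis,
since the metric terms of the tensor drop out for such indices.

For the polynomial of a Steiner triple system, `x_a ∘ x_b` is the third point of the block through
`a` and `b`, so the identity on basis vectors is the Veblen–Young axiom. It makes the Steiner loop
associative, hence a group of order `n + 1` in which every element is its own inverse. So `n + 1` is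
a power of two, which excludes `n ≡ 1 (mod 4)`.
-/

open scoped Matrix

/-- A triple system is projective if it satisfies the Veblen–Young axiom, which for lines with three
points says that whenever `ab` and `cd` meet, so do `ac` and `bd`. Stated through blocks, since
`{a, b, p} ∈ B` forces `a`, `b`, `p` to be distinct when every block has three elements. -/
def IsProjectiveTripleSystem {n : ℕ} (B : Finset (Finset (Fin n))) : Prop :=
  ∀ ⦃a b c d p q : Fin n⦄, {a, b, p} ∈ B → {c, d, p} ∈ B → {a, c, q} ∈ B → {b, d, q} ∈ B

/-- The product of the Steiner loop of a triple system: adjoin an identity `none` to the points,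
and let `x * x` be the identity and `x * y` the third point of the block through `x ≠ y`. The
existential below fails for `i = j` when every block has three elements. -/
noncomputable def steinerLoopMul {n : ℕ} (B : Finset (Finset (Fin n))) :
    Option (Fin n) → Option (Fin n) → Option (Fin n)
  | none, y => y
  | some i, none => some i
  | some i, some j => if h : ∃ k, {i, j, k} ∈ B then some h.choose else none

theorem steinerLoopMul_none {n : ℕ} (B : Finset (Finset (Fin n))) (x : Option (Fin n)) :
    steinerLoopMul B x none = x := by
  cases x <;> rfl

theorem triple_rotate {α : Type*} [DecidableEq α] (a b c : α) :
    ({a, b, c} : Finset α) = {b, c, a} := by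
  rw [Finset.insert_comm, Finset.pair_comm]

namespace IsSteinerTripleSystem

variable {n : ℕ} {B : Finset (Finset (Fin n))} {i j k l : Fin n}

theorem ne_of_mem (hB : IsSteinerTripleSystem B) (h : {i, j, k} ∈ B) : i ≠ j := by
  rintro rfl
  have hcard := hB.card_block _ h
  rw [Finset.insert_idem] at hcard
  have := Finset.card_le_two (a := i) (b := k)
  omega

theorem exists_block (hB : IsSteinerTripleSystem B) (hij : i ≠ j) : ∃ k, {i, j, k} ∈ B := by
  obtain ⟨b, ⟨hb, hi, hj⟩, -⟩ := hB.existsUnique_block i j hij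
  have hcard : (b \ {i, j}).card = 1 := by
    rw [Finset.card_sdiff_of_subset (by simp [Finset.insert_subset_iff, hi, hj]),
      hB.card_block b hb, Finset.card_pair hij]
  obtain ⟨k, hk⟩ := Finset.card_eq_one.1 hcard
  have hb_eq : {i, j, k} = b := by grind
  exact ⟨k, hb_eq ▸ hb⟩

theorem block_unique (hB : IsSteinerTripleSystem B) (hk : {i, j, k} ∈ B) (hl : {i, j, l} ∈ B) :
    k = l := by
  have hij : i ≠ j := hB.ne_of_mem hk
  have hjk : j ≠ k := hB.ne_of_mem (triple_rotate i j k ▸ hk)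
  have hki : k ≠ i := hB.ne_of_mem (triple_rotate k i j ▸ hk)
  have heq : ({i, j, k} : Finset (Fin n)) = {i, j, l} :=
    (hB.existsUnique_block i j hij).unique ⟨hk, by simp, by simp⟩ ⟨hl, by simp, by simp⟩
  have hmem : k ∈ ({i, j, l} : Finset (Fin n)) := heq ▸ by simp
  simpa [hki, hjk.symm] using hmem

theorem steinerLoopMul_eq_some_iff (hB : IsSteinerTripleSystem B) :
    steinerLoopMul B (some i) (some j) = some k ↔ {i, j, k} ∈ B := by
  simp only [steinerLoopMul]
  split_ifs with h
  · rw [Option.some_inj]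
    exact ⟨fun hk => hk ▸ h.choose_spec, hB.block_unique h.choose_spec⟩
  · exact ⟨nofun, fun hk => absurd ⟨k, hk⟩ h⟩

theorem steinerLoopMul_self (hB : IsSteinerTripleSystem B) (x : Option (Fin n)) :
    steinerLoopMul B x x = none := by
  cases x with
  | none => rfl
  | some i => exact dif_neg fun ⟨_, hk⟩ => hB.ne_of_mem hk rfl

theorem steinerLoopMul_left_cancel (hB : IsSteinerTripleSystem B) (x y : Option (Fin n)) :
    steinerLoopMul B x (steinerLoopMul B x y) = y := by
  rcases x with _ | i <;> rcases y with _ | j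
  any_goals rfl
  · exact hB.steinerLoopMul_self _
  · obtain rfl | hij := eq_or_ne i j
    · rw [hB.steinerLoopMul_self]; rfl
    · obtain ⟨k, hk⟩ := hB.exists_block hij
      rw [hB.steinerLoopMul_eq_some_iff.2 hk, hB.steinerLoopMul_eq_some_iff, Finset.pair_comm]
      exact hk

theorem steinerLoopMul_right_cancel (hB : IsSteinerTripleSystem B) (x y : Option (Fin n)) :
    steinerLoopMul B (steinerLoopMul B x y) y = x := by
  rcases x with _ | i <;> rcases y with _ | j
  any_goals rfl
  · exact hB.steinerLoopMul_self _
  · obtain rfl | hij := eq_or_ne i j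
    · rw [hB.steinerLoopMul_self]; rfl
    · obtain ⟨k, hk⟩ := hB.exists_block hij
      rw [hB.steinerLoopMul_eq_some_iff.2 hk, hB.steinerLoopMul_eq_some_iff, triple_rotate,
        Finset.insert_comm]
      exact hk

theorem steinerLoopMul_assoc (hB : IsSteinerTripleSystem B) (hproj : IsProjectiveTripleSystem B)
    (x y z : Option (Fin n)) :
    steinerLoopMul B (steinerLoopMul B x y) z = steinerLoopMul B x (steinerLoopMul B y z) := by
  rcases x with _ | a
  · rfl
  rcases y with _ | b
  · rfl
  rcases z with _ | c
  · exact steinerLoopMul_none B _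
  obtain rfl | hab := eq_or_ne a b
  · rw [hB.steinerLoopMul_self, hB.steinerLoopMul_left_cancel]; rfl
  obtain rfl | hbc := eq_or_ne b c
  · rw [hB.steinerLoopMul_self, hB.steinerLoopMul_right_cancel]; rfl
  obtain ⟨p, hp⟩ := hB.exists_block hab
  obtain ⟨q, hq⟩ := hB.exists_block hbc
  rw [hB.steinerLoopMul_eq_some_iff.2 hp, hB.steinerLoopMul_eq_some_iff.2 hq]
  obtain rfl | haq := eq_or_ne a q
  · obtain rfl : p = c := hB.block_unique hp (by rwa [triple_rotate])
    simp only [hB.steinerLoopMul_self]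
  · obtain ⟨s, hs⟩ := hB.exists_block haq
    rw [hB.steinerLoopMul_eq_some_iff.2 hs, hB.steinerLoopMul_eq_some_iff]
    rw [Finset.pair_comm] at hp
    rw [triple_rotate, Finset.insert_comm] at hq
    exact hproj hp hq hs

theorem exists_add_one_eq_two_pow (hB : IsSteinerTripleSystem B)
    (hproj : IsProjectiveTripleSystem B) : ∃ m, n + 1 = 2 ^ m := by
  let : Mul (Option (Fin n)) := ⟨steinerLoopMul B⟩
  let : One (Option (Fin n)) := ⟨none⟩
  let : Inv (Option (Fin n)) := ⟨id⟩
  let : Group (Option (Fin n)) := Group.ofLeftAxioms (hB.steinerLoopMul_assoc hproj)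
    (fun _ => rfl) hB.steinerLoopMul_self
  have hexp : IsPGroup 2 (Option (Fin n)) := fun x =>
    ⟨1, by rw [pow_one, pow_two]; exact hB.steinerLoopMul_self x⟩
  obtain ⟨m, hm⟩ := IsPGroup.iff_card.1 hexp
  exact ⟨m, by simpa using hm⟩

theorem not_isProjectiveTripleSystem (hB : IsSteinerTripleSystem B) (hn : 2 ≤ n)
    (hmod : n % 4 = 1) : ¬ IsProjectiveTripleSystem B := by
  intro hproj
  obtain ⟨m, hm⟩ := hB.exists_add_one_eq_two_pow hproj
  rcases m with _ | _ | m
  all_goals simp only [pow_succ, pow_zero] at hm; omega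

end IsSteinerTripleSystem

section DirectionalDerivative

variable {σ R : Type*} [CommSemiring R]

/-- The derivative of polynomials in the constant direction `v`. -/
noncomputable def dirDeriv (v : σ → R) : Derivation R (MvPolynomial σ R) (MvPolynomial σ R) :=
  mkDerivation R fun i => C (v i)

@[simp]
theorem dirDeriv_X (v : σ → R) (i : σ) : dirDeriv v (X i) = C (v i) :=
  mkDerivation_X R _ i

theorem dirDeriv_single [DecidableEq σ] (i : σ) :
    dirDeriv (Pi.single i (1 : R)) = pderiv i := by
  refine derivation_ext fun j => ?_
  rw [dirDeriv_X, pderiv_X]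
  obtain rfl | hij := eq_or_ne i j <;> simp [*]

theorem dirDeriv_apply_eq_sum [Fintype σ] (v : σ → R) (P : MvPolynomial σ R) :
    dirDeriv v P = ∑ i, v i • pderiv i P := by
  classical
  have hsum (Q : MvPolynomial σ R) : (∑ i, v i • pderiv (R := R) i) Q = ∑ i, v i • pderiv i Q :=
    (congrFun (map_sum Derivation.coeFnAddMonoidHom (fun i => v i • pderiv i) _) Q).trans
      (by simp [Finset.sum_apply])
  have hderiv : dirDeriv v = ∑ i, v i • pderiv i :=
    derivation_ext fun j => by simp [hsum, pderiv_X, Pi.single_apply, smul_eq_C_mul]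
  rw [hderiv, hsum]

end DirectionalDerivative

theorem dirDeriv_glAct {n : ℕ} (g : GL (Fin n) ℝ) (v : Fin n → ℝ) (P : MvPolynomial (Fin n) ℝ) :
    dirDeriv v (glAct g P) = glAct g (dirDeriv (g⁻¹.val *ᵥ v) P) := by
  unfold glAct
  induction P using MvPolynomial.induction_on with
  | C a => simp
  | add p q hp hq => simp only [map_add, hp, hq]
  | mul_X p i hp =>
    simp only [map_mul, aeval_X, Derivation.leibniz, hp, map_add, smul_eq_mul, map_sum, dirDeriv_X,
      aeval_C]
    simp [Matrix.mulVec, dotProduct]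

/-- The coordinates of the product `x ∘ y` of the commutative algebra of a cubic polynomial `P`,
defined by `⟨x ∘ y, z⟩ = D³P(x, y, z)`. The third derivative is taken at the origin, so that the
product is real-valued for every `P`. -/
noncomputable def cubicMul {n : ℕ} (P : MvPolynomial (Fin n) ℝ) (x y : Fin n → ℝ) : Fin n → ℝ :=
  fun p => eval 0 (dirDeriv x (dirDeriv y (pderiv p P)))

section CubicMul

variable {n : ℕ}

theorem cubicMul_dotProduct (P : MvPolynomial (Fin n) ℝ) (x y z : Fin n → ℝ) :
    cubicMul P x y ⬝ᵥ z = eval 0 (dirDeriv x (dirDeriv y (dirDeriv z P))) := by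
  simp [cubicMul, dotProduct, dirDeriv_apply_eq_sum z, mul_comm]

theorem cubicMul_single (P : MvPolynomial (Fin n) ℝ) (i j p : Fin n) :
    cubicMul P (Pi.single i 1) (Pi.single j 1) p = eval 0 (thirdDeriv P i j p) := by
  simp only [cubicMul, dirDeriv_single, thirdDeriv]

theorem cubicMul_glAct (g : GL (Fin n) ℝ) (P : MvPolynomial (Fin n) ℝ) (x y : Fin n → ℝ) :
    cubicMul (glAct g P) x y = cubicMul P (g⁻¹.val *ᵥ x) (g⁻¹.val *ᵥ y) ᵥ* g⁻¹.val := by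
  ext p
  rw [← dotProduct_single_one (cubicMul _ _ _), cubicMul_dotProduct, dirDeriv_glAct, dirDeriv_glAct,
    dirDeriv_glAct, eval_glAct, Matrix.mulVec_zero, ← cubicMul_dotProduct, Matrix.dotProduct_mulVec,
    dotProduct_single_one]

end CubicMul

theorem exists_vecMul_dotProduct_vecMul {n : ℕ} {g : GL (Fin n) ℝ}
    (hg : g ∈ conformalLinearGroup n) :
    ∃ s : ℝ, s ≠ 0 ∧ ∀ x y, (x ᵥ* g.val) ⬝ᵥ (y ᵥ* g.val) = s * (x ⬝ᵥ y) := by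
  obtain ⟨r, hr, A, hA, hgA⟩ := hg
  have hAAt : A * Aᵀ = 1 := (Matrix.mem_orthogonalGroup_iff _ _).1 hA
  refine ⟨r * r, mul_ne_zero hr hr, fun x y => ?_⟩
  rw [← Matrix.mulVec_transpose _ y, Matrix.dotProduct_mulVec, Matrix.vecMul_vecMul, hgA,
    Matrix.transpose_smul, Matrix.smul_mul, Matrix.mul_smul, hAAt, smul_smul, Matrix.vecMul_smul,
    Matrix.vecMul_one, smul_dotProduct, smul_eq_mul]

theorem exists_mulVec_dotProduct_mulVec {n : ℕ} {g : GL (Fin n) ℝ}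
    (hg : g ∈ conformalLinearGroup n) :
    ∃ s : ℝ, ∀ x y, (g.val *ᵥ x) ⬝ᵥ (g.val *ᵥ y) = s * (x ⬝ᵥ y) := by
  obtain ⟨r, -, A, hA, hgA⟩ := hg
  have hAtA : Aᵀ * A = 1 := (Matrix.mem_orthogonalGroup_iff' _ _).1 hA
  refine ⟨r * r, fun x y => ?_⟩
  rw [Matrix.dotProduct_mulVec, ← Matrix.mulVec_transpose, Matrix.mulVec_mulVec, hgA,
    Matrix.transpose_smul, Matrix.smul_mul, Matrix.mul_smul, hAtA, smul_smul, Matrix.smul_mulVec,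
    Matrix.one_mulVec, smul_dotProduct, smul_eq_mul]

/-- The algebra of `P` satisfies `⟨a ∘ b, c ∘ d⟩ = ⟨a ∘ c, b ∘ d⟩` under the orthogonality
conditions that kill the metric terms of the conformal nonassociativity tensor. Quantifying over all
vectors makes this consequence of conformal associativity invariant under the conformal group. -/
def IsOrthogonallyAssociative {n : ℕ} (P : MvPolynomial (Fin n) ℝ) : Prop :=
  ∀ a b c d : Fin n → ℝ, a ⬝ᵥ b = 0 → a ⬝ᵥ c = 0 → b ⬝ᵥ d = 0 → c ⬝ᵥ d = 0 →
    cubicMul P a b ⬝ᵥ cubicMul P c d = cubicMul P a c ⬝ᵥ cubicMul P b d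

theorem IsOrthogonallyAssociative.of_glAct {n : ℕ} {P : MvPolynomial (Fin n) ℝ} {g : GL (Fin n) ℝ}
    (hg : g ∈ conformalLinearGroup n) (h : IsOrthogonallyAssociative (glAct g P)) :
    IsOrthogonallyAssociative P := by
  intro a b c d hab hac hbd hcd
  obtain ⟨r, hr⟩ := exists_mulVec_dotProduct_mulVec hg
  obtain ⟨s, hs, hdot⟩ := exists_vecMul_dotProduct_vecMul (inv_mem hg)
  have hmul (x y : Fin n → ℝ) :
      cubicMul (glAct g P) (g.val *ᵥ x) (g.val *ᵥ y) = cubicMul P x y ᵥ* g⁻¹.val := by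
    simp [cubicMul_glAct]
  have hassoc := h (g.val *ᵥ a) (g.val *ᵥ b) (g.val *ᵥ c) (g.val *ᵥ d)
    (by rw [hr, hab, mul_zero]) (by rw [hr, hac, mul_zero]) (by rw [hr, hbd, mul_zero])
    (by rw [hr, hcd, mul_zero])
  rw [hmul, hmul, hmul, hmul, hdot, hdot] at hassoc
  exact mul_left_cancel₀ hs hassoc

theorem pderiv_prod_X {σ R : Type*} [CommSemiring R] [DecidableEq σ] (s : Finset σ) (i : σ) :
    pderiv i (∏ a ∈ s, (X a : MvPolynomial σ R)) = if i ∈ s then ∏ a ∈ s.erase i, X a else 0 := by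
  have hnotMem (t : Finset σ) (ht : i ∉ t) : pderiv i (∏ a ∈ t, (X a : MvPolynomial σ R)) = 0 := by
    refine Finset.prod_induction _ (fun Q => pderiv i Q = 0) (fun P Q hP hQ => ?_)
      (Derivation.map_one_eq_zero _) fun a ha => pderiv_X_of_ne (ne_of_mem_of_not_mem ha ht)
    rw [Derivation.leibniz, hP, hQ, smul_zero, smul_zero, add_zero]
  split_ifs with hi
  · rw [← Finset.mul_prod_erase s _ hi, Derivation.leibniz, pderiv_X_self,
      hnotMem _ (Finset.notMem_erase i s)]
    simp
  · exact hnotMem s hi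

theorem thirdDeriv_prod_X {n : ℕ} {b : Finset (Fin n)} (hb : b.card = 3) (i j k : Fin n) :
    thirdDeriv (∏ a ∈ b, X a) i j k = if {i, j, k} = b then 1 else 0 := by
  have hiff : {i, j, k} = b ↔ k ∈ b ∧ j ∈ b.erase k ∧ i ∈ (b.erase k).erase j := by
    obtain ⟨x, y, z, _, _, _, rfl⟩ := Finset.card_eq_three.1 hb
    grind
  simp only [thirdDeriv, pderiv_prod_X, apply_ite (pderiv _), map_zero, ← ite_and, and_assoc, hiff]
  refine ite_congr rfl (fun ⟨hk, hj, hi⟩ => ?_) fun _ => rfl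
  have hempty : ((b.erase k).erase j).erase i = ∅ := by
    rw [← Finset.card_eq_zero, Finset.card_erase_of_mem hi, Finset.card_erase_of_mem hj,
      Finset.card_erase_of_mem hk, hb]
  rw [hempty, Finset.prod_empty]

theorem thirdDeriv_steinerCubic {n : ℕ} {B : Finset (Finset (Fin n))}
    (hB : ∀ b ∈ B, b.card = 3) (i j k : Fin n) :
    thirdDeriv (steinerCubic B) i j k = if {i, j, k} ∈ B then 1 else 0 := by
  calc thirdDeriv (steinerCubic B) i j k
    _ = ∑ b ∈ B, thirdDeriv (∏ a ∈ b, X a) i j k := by simp only [thirdDeriv, steinerCubic, map_sum]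
    _ = ∑ b ∈ B, if {i, j, k} = b then 1 else 0 :=
      Finset.sum_congr rfl fun b hb => thirdDeriv_prod_X (hB b hb) i j k
    _ = if {i, j, k} ∈ B then 1 else 0 := Finset.sum_ite_eq B _ _

theorem cubicMul_steinerCubic_dotProduct {n : ℕ} {B : Finset (Finset (Fin n))}
    (hB : ∀ b ∈ B, b.card = 3) (a b c d : Fin n) :
    cubicMul (steinerCubic B) (Pi.single a 1) (Pi.single b 1) ⬝ᵥ
        cubicMul (steinerCubic B) (Pi.single c 1) (Pi.single d 1) =
      (Finset.univ.filter fun p => {a, b, p} ∈ B ∧ {c, d, p} ∈ B).card := by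
  simp only [dotProduct, cubicMul_single, thirdDeriv_steinerCubic hB, apply_ite (eval 0),
    map_one, map_zero, ite_zero_mul_ite_zero, mul_one, Finset.sum_boole]

theorem IsSteinerTripleSystem.isProjectiveTripleSystem_of_cubicMul_dotProduct_eq {n : ℕ}
    {B : Finset (Finset (Fin n))} (hB : IsSteinerTripleSystem B)
    (hassoc : ∀ a b c d : Fin n, a ≠ b → a ≠ c → b ≠ d → c ≠ d →
      cubicMul (steinerCubic B) (Pi.single a 1) (Pi.single b 1) ⬝ᵥ
          cubicMul (steinerCubic B) (Pi.single c 1) (Pi.single d 1) =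
        cubicMul (steinerCubic B) (Pi.single a 1) (Pi.single c 1) ⬝ᵥ
          cubicMul (steinerCubic B) (Pi.single b 1) (Pi.single d 1)) :
    IsProjectiveTripleSystem B := by
  intro a b c d p q habp hcdp hacq
  have hab : a ≠ b := hB.ne_of_mem habp
  have hac : a ≠ c := hB.ne_of_mem hacq
  have hcd : c ≠ d := hB.ne_of_mem hcdp
  have hbd : b ≠ d := by
    rintro rfl
    rw [triple_rotate] at habp
    rw [Finset.insert_comm, Finset.pair_comm] at hcdp
    exact hac (hB.block_unique habp hcdp)
  have hcard := hassoc a b c d hab hac hbd hcd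
  rw [cubicMul_steinerCubic_dotProduct hB.card_block,
    cubicMul_steinerCubic_dotProduct hB.card_block, Nat.cast_inj] at hcard
  obtain ⟨q', hq'⟩ : (Finset.univ.filter fun q => {a, c, q} ∈ B ∧ {b, d, q} ∈ B).Nonempty := by
    rw [← Finset.card_pos, ← hcard, Finset.card_pos]
    exact ⟨p, by simp [habp, hcdp]⟩
  obtain ⟨hacq', hbdq'⟩ := (Finset.mem_filter.1 hq').2
  rwa [hB.block_unique hacq hacq']

theorem IsOrthogonallyAssociative.isProjectiveTripleSystem {n : ℕ} {B : Finset (Finset (Fin n))}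
    (hB : IsSteinerTripleSystem B) (h : IsOrthogonallyAssociative (steinerCubic B)) :
    IsProjectiveTripleSystem B :=
  hB.isProjectiveTripleSystem_of_cubicMul_dotProduct_eq fun a b c d hab hac hbd hcd =>
    h _ _ _ _ (by simp [hab]) (by simp [hac]) (by simp [hbd]) (by simp [hcd])

theorem ConformallyAssociative.cubicMul_dotProduct_swap {n : ℕ} {P : MvPolynomial (Fin n) ℝ}
    (h : ConformallyAssociative P) {a b c d : Fin n} (hab : a ≠ b) (hac : a ≠ c) (hbd : b ≠ d)
    (hcd : c ≠ d) :
    cubicMul P (Pi.single a 1) (Pi.single b 1) ⬝ᵥ cubicMul P (Pi.single c 1) (Pi.single d 1) =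
      cubicMul P (Pi.single a 1) (Pi.single c 1) ⬝ᵥ
        cubicMul P (Pi.single b 1) (Pi.single d 1) := by
  -- In the index order `b c d a` the metric terms vanish, and the tensor itself is
  -- `⟨a ∘ b, c ∘ d⟩ - ⟨a ∘ c, b ∘ d⟩`.
  have hA : nonassociativity P b c d a = 0 := by
    simpa [conformalNonassociativity, euclideanMetric, hab, hac, hbd.symm, hcd.symm] using h b c d a
  have heval := congrArg (eval 0) hA
  simp only [nonassociativity, map_sum, map_sub, map_mul, map_zero, Finset.sum_sub_distrib] at heval
  simpa only [dotProduct, cubicMul_single] using sub_eq_zero.1 heval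

/-- The sum of the cubes of the linear forms given by the rows of `H`. -/
noncomputable def sumCubes {m n : ℕ} (H : Matrix (Fin m) (Fin n) ℝ) : MvPolynomial (Fin n) ℝ :=
  ∑ i, (∑ j, C (H i j) * X j) ^ 3

theorem eval_sumCubes {m n : ℕ} (H : Matrix (Fin m) (Fin n) ℝ) (x : Fin n → ℝ) :
    eval x (sumCubes H) = ∑ i, (H *ᵥ x) i ^ 3 := by
  simp [sumCubes, Matrix.mulVec, dotProduct]

theorem dirDeriv_dirDeriv_dirDeriv_pow_three {σ R : Type*} [CommSemiring R] {u v w : σ → R}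
    {L : MvPolynomial σ R} {a b c : R} (ha : dirDeriv u L = C a) (hb : dirDeriv v L = C b)
    (hc : dirDeriv w L = C c) :
    dirDeriv u (dirDeriv v (dirDeriv w (L ^ 3))) = C (6 * (a * b * c)) := by
  have hthree : dirDeriv w (L ^ 3) = (3 * c) • L ^ 2 := by
    simp only [Derivation.leibniz_pow, hc, smul_eq_C_mul, C_mul, map_ofNat, smul_eq_mul,
      nsmul_eq_mul, Nat.cast_ofNat]
    ring
  have htwo : dirDeriv v (L ^ 2) = (2 * b) • L := by
    simp only [Derivation.leibniz_pow, hb, smul_eq_C_mul, C_mul, map_ofNat, smul_eq_mul,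
      nsmul_eq_mul, Nat.cast_ofNat]
    ring
  rw [hthree, Derivation.map_smul, htwo, Derivation.map_smul, Derivation.map_smul, ha,
    smul_eq_C_mul, smul_eq_C_mul, ← C_mul, ← C_mul]
  ring_nf

theorem cubicMul_C_mul_sumCubes {m n : ℕ} (s : ℝ) (H : Matrix (Fin m) (Fin n) ℝ)
    (x y : Fin n → ℝ) :
    cubicMul (C s * sumCubes H) x y = (6 * s) • ((H *ᵥ x * H *ᵥ y) ᵥ* H) := by
  have hlinear (v : Fin n → ℝ) (i : Fin m) :
      dirDeriv v (∑ j, C (H i j) * X j) = C ((H *ᵥ v) i) := by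
    simp [Matrix.mulVec, dotProduct]
  ext p
  have hderiv : dirDeriv x (dirDeriv y (pderiv p (sumCubes H))) =
      ∑ i, C (6 * ((H *ᵥ x) i * (H *ᵥ y) i * H i p)) := by
    rw [sumCubes, map_sum, map_sum, map_sum]
    refine Finset.sum_congr rfl fun i _ => ?_
    rw [← dirDeriv_single, dirDeriv_dirDeriv_dirDeriv_pow_three (hlinear x i) (hlinear y i)
      (hlinear _ i), Matrix.mulVec_single_one, Matrix.col_apply]
  rw [cubicMul, ← smul_eq_C_mul, Derivation.map_smul, Derivation.map_smul, Derivation.map_smul,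
    hderiv, smul_eval, map_sum]
  simp only [eval_C, Pi.smul_apply, Pi.mul_apply, Matrix.vecMul, dotProduct, smul_eq_mul,
    ← Finset.mul_sum]
  ring

theorem sum_add_pow_three_of_sum_eq_zero {ι R : Type*} [Fintype ι] [CommRing R] {y : ι → R}
    (hy : ∑ i, y i = 0) (t : R) :
    ∑ i, (y i + t) ^ 3 = ∑ i, y i ^ 3 + 3 * t * ∑ i, y i ^ 2 + Fintype.card ι * t ^ 3 := by
  have hexpand (i : ι) : (y i + t) ^ 3 = y i ^ 3 + 3 * t * y i ^ 2 + 3 * t ^ 2 * y i + t ^ 3 := by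
    ring
  simp [hexpand, Finset.sum_add_distrib, ← Finset.mul_sum, hy]

/-- The factor that normalizes a column of the Helmert matrix. -/
noncomputable def helmertScale (j : ℕ) : ℝ := 1 / √((j + 1 : ℝ) * (j + 2 : ℝ))

theorem helmertScale_sq_mul (j : ℕ) : helmertScale j ^ 2 * ((j + 1) * (j + 2)) = 1 := by
  rw [helmertScale, one_div, inv_pow, Real.sq_sqrt (by positivity)]
  exact inv_mul_cancel₀ (by positivity)

/-- The Helmert matrix with its constant column left out: its columns are an orthonormal basis of
the vectors with coordinate sum zero, and its rows are the vertices of a regular simplex centred at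
the origin of `ℝⁿ`. Comparing indices as natural numbers makes `helmert n` a block of
`helmert (n + 1)`. -/
noncomputable def helmert (n : ℕ) : Matrix (Fin (n + 1)) (Fin n) ℝ := fun i j =>
  helmertScale j * if (i : ℕ) ≤ j then 1 else if (i : ℕ) = j + 1 then -((j : ℝ) + 1) else 0

section Helmert

variable {n : ℕ}

@[simp]
theorem helmert_castSucc_castSucc (i : Fin (n + 1)) (j : Fin n) :
    helmert (n + 1) i.castSucc j.castSucc = helmert n i j := rfl

@[simp]
theorem helmert_last_castSucc (j : Fin n) : helmert (n + 1) (Fin.last (n + 1)) j.castSucc = 0 := by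
  have h₁ : ¬ n + 1 ≤ (j : ℕ) := by omega
  have h₂ : n ≠ j := by omega
  simp [helmert, h₁, h₂]

@[simp]
theorem helmert_castSucc_last (i : Fin (n + 1)) :
    helmert (n + 1) i.castSucc (Fin.last n) = helmertScale n := by
  simp [helmert, i.is_le]

@[simp]
theorem helmert_last_last (n : ℕ) :
    helmert (n + 1) (Fin.last (n + 1)) (Fin.last n) = -(helmertScale n * (n + 1)) := by
  simp [helmert, mul_add]

theorem sum_helmert (j : Fin n) : ∑ i, helmert n i j = 0 := by
  induction n with
  | zero => exact j.elim0
  | succ n ih =>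
    rw [Fin.sum_univ_castSucc]
    cases j using Fin.lastCases with
    | last =>
      simp only [helmert_castSucc_last, helmert_last_last, Finset.sum_const, Finset.card_univ,
        Fintype.card_fin, nsmul_eq_mul, Nat.cast_add_one]
      ring
    | cast j => simp [ih]

theorem sum_helmert_mul_helmert (j k : Fin n) :
    ∑ i, helmert n i j * helmert n i k = if j = k then 1 else 0 := by
  induction n with
  | zero => exact j.elim0
  | succ n ih =>
    rw [Fin.sum_univ_castSucc]
    cases j using Fin.lastCases with
    | last =>
      cases k using Fin.lastCases with
      | last =>
        simp only [helmert_castSucc_last, helmert_last_last, Finset.sum_const, Finset.card_univ,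
          Fintype.card_fin, nsmul_eq_mul, Nat.cast_add_one, if_true]
        linear_combination helmertScale_sq_mul n
      | cast k => simp [← Finset.mul_sum, sum_helmert, (Fin.castSucc_ne_last k).symm]
    | cast j =>
      cases k using Fin.lastCases with
      | last => simp [← Finset.sum_mul, sum_helmert, Fin.castSucc_ne_last]
      | cast k => simp [ih]

theorem helmert_dotProduct_helmert (i k : Fin (n + 1)) :
    helmert n i ⬝ᵥ helmert n k = (if i = k then 1 else 0) - 1 / (n + 1) := by
  induction n with
  | zero => simp [Fin.fin_one_eq_zero]
  | succ n ih =>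
    have hfirst : 1 / (n + 1 : ℝ) = helmertScale n ^ 2 * (n + 2) := by
      field_simp
      linear_combination -helmertScale_sq_mul n
    have hlast : 1 / (n + 2 : ℝ) = helmertScale n ^ 2 * (n + 1) := by
      field_simp
      linear_combination -helmertScale_sq_mul n
    simp only [dotProduct] at ih
    rw [dotProduct, Fin.sum_univ_castSucc, Nat.cast_add_one]
    cases i using Fin.lastCases with
    | last =>
      cases k using Fin.lastCases with
      | last =>
        simp only [helmert_last_castSucc, helmert_last_last, mul_zero, Finset.sum_const_zero,
          if_true]
        linear_combination helmertScale_sq_mul n + hlast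
      | cast k =>
        simp only [helmert_last_castSucc, helmert_last_last, helmert_castSucc_last, zero_mul,
          Finset.sum_const_zero, (Fin.castSucc_ne_last k).symm, if_false]
        linear_combination hlast
    | cast i =>
      cases k using Fin.lastCases with
      | last =>
        simp only [helmert_last_castSucc, helmert_last_last, helmert_castSucc_last, mul_zero,
          Finset.sum_const_zero, Fin.castSucc_ne_last, if_false]
        linear_combination hlast
      | cast k =>
        simp only [helmert_castSucc_castSucc, helmert_castSucc_last, ih, Fin.castSucc_inj]
        linear_combination hlast - hfirst

theorem sum_helmert_mulVec (x : Fin n → ℝ) : ∑ i, (helmert n *ᵥ x) i = 0 := by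
  simp only [Matrix.mulVec, dotProduct]
  rw [Finset.sum_comm]
  simp only [← Finset.sum_mul, sum_helmert, zero_mul, Finset.sum_const_zero]

theorem helmert_mulVec_dotProduct_helmert_mulVec (x y : Fin n → ℝ) :
    (helmert n *ᵥ x) ⬝ᵥ (helmert n *ᵥ y) = x ⬝ᵥ y := by
  have horth : (helmert n)ᵀ * helmert n = 1 := by
    ext j k
    rw [Matrix.mul_apply, Matrix.one_apply, ← sum_helmert_mul_helmert]
    rfl
  rw [Matrix.dotProduct_mulVec, ← Matrix.mulVec_transpose, Matrix.mulVec_mulVec, horth,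
    Matrix.one_mulVec]

theorem vecMul_helmert_dotProduct_vecMul_helmert (u v : Fin (n + 1) → ℝ) :
    (u ᵥ* helmert n) ⬝ᵥ (v ᵥ* helmert n) = u ⬝ᵥ v - (∑ i, u i) * (∑ i, v i) / (n + 1) := by
  have hmul : helmert n * (helmert n)ᵀ = 1 - (1 / (n + 1 : ℝ)) • Matrix.vecMulVec 1 1 := by
    ext i k
    rw [Matrix.mul_apply]
    exact (helmert_dotProduct_helmert i k).trans (by simp [Matrix.one_apply, Matrix.vecMulVec])
  rw [← Matrix.mulVec_transpose _ v, Matrix.dotProduct_mulVec, Matrix.vecMul_vecMul, hmul,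
    Matrix.vecMul_sub, Matrix.vecMul_one, Matrix.vecMul_smul, Matrix.vecMul_vecMulVec,
    sub_dotProduct, smul_dotProduct, smul_dotProduct, dotProduct_one, one_dotProduct, smul_eq_mul,
    smul_eq_mul]
  ring

theorem sum_helmert_mulVec_pow_three (x : Fin n → ℝ) :
    ∑ i, (helmert n *ᵥ x) i ^ 3 =
      -∑ j : Fin n, helmertScale j * ∑ i ∈ Finset.Iio j, (x j ^ 3 - 3 * x j * x i ^ 2) := by
  induction n with
  | zero => simp
  | succ n ih =>
    let x' : Fin n → ℝ := fun i => x i.castSucc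
    let y := helmert n *ᵥ x'
    let t := helmertScale n * x (Fin.last n)
    have hcast (i : Fin (n + 1)) : (helmert (n + 1) *ᵥ x) i.castSucc = y i + t := by
      simp [x', y, t, Matrix.mulVec, dotProduct, Fin.sum_univ_castSucc]
    have hlast : (helmert (n + 1) *ᵥ x) (Fin.last (n + 1)) = -((n + 1) * t) := by
      simp only [t, Matrix.mulVec, dotProduct, Fin.sum_univ_castSucc, helmert_last_castSucc,
        helmert_last_last, zero_mul, Finset.sum_const_zero]
      ring
    have hsq : ∑ i, y i ^ 2 = ∑ i, x' i ^ 2 := by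
      simpa only [dotProduct, pow_two] using helmert_mulVec_dotProduct_helmert_mulVec x' x'
    have hnew : ∑ i ∈ Finset.Iio (Fin.last n), (x (Fin.last n) ^ 3 - 3 * x (Fin.last n) * x i ^ 2) =
        n * x (Fin.last n) ^ 3 - 3 * x (Fin.last n) * ∑ i, x' i ^ 2 := by
      simp [x', Fin.Iio_last_eq_map, Finset.sum_sub_distrib, Finset.mul_sum]
    rw [Fin.sum_univ_castSucc]
    simp only [hcast, hlast]
    rw [sum_add_pow_three_of_sum_eq_zero (sum_helmert_mulVec x'), hsq, ih x', Fintype.card_fin,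
      Nat.cast_add_one, Fin.sum_univ_castSucc, Fin.val_last, hnew]
    simp only [Fin.sum_Iio_castSucc, Fin.val_castSucc]
    linear_combination -n * helmertScale n * x (Fin.last n) ^ 3 * helmertScale_sq_mul n

end Helmert

theorem simplicialPoly_eq_C_mul_sumCubes (n : ℕ) :
    simplicialPoly n = C (-(√((n : ℝ) * (n + 1)) / 6)) * sumCubes (helmert n) := by
  refine MvPolynomial.funext fun x => ?_
  rw [map_mul, eval_sumCubes, sum_helmert_mulVec_pow_three]
  simp [simplicialPoly, helmertScale]

theorem isOrthogonallyAssociative_simplicialPoly (n : ℕ) :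
    IsOrthogonallyAssociative (simplicialPoly n) := by
  have hsum {x y : Fin n → ℝ} (hxy : x ⬝ᵥ y = 0) :
      ∑ i, (helmert n *ᵥ x * helmert n *ᵥ y) i = 0 :=
    (helmert_mulVec_dotProduct_helmert_mulVec x y).trans hxy
  intro a b c d hab hac _ _
  simp only [simplicialPoly_eq_C_mul_sumCubes, cubicMul_C_mul_sumCubes, smul_dotProduct,
    dotProduct_smul, vecMul_helmert_dotProduct_vecMul_helmert, hsum hab, hsum hac, zero_mul]
  congr 3
  exact Finset.sum_congr rfl fun i _ => mul_mul_mul_comm _ _ _ _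

theorem mainTheorem7_general {n : ℕ} {B : Finset (Finset (Fin n))} (hB : IsSteinerTripleSystem B)
    (hproj : ¬ IsProjectiveTripleSystem B) :
    ¬ ConformallyEquivalent (steinerCubic B) (simplicialPoly n) ∧
      ¬ ConformallyAssociative (steinerCubic B) := by
  constructor
  · rintro ⟨g, hg, hgB⟩
    have hassoc : IsOrthogonallyAssociative (steinerCubic B) :=
      .of_glAct hg (hgB ▸ isOrthogonallyAssociative_simplicialPoly n)
    exact hproj (hassoc.isProjectiveTripleSystem hB)
  · intro hassoc
    exact hproj (hB.isProjectiveTripleSystem_of_cubicMul_dotProduct_eq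
      fun _ _ _ _ => hassoc.cubicMul_dotProduct_swap)

theorem mainTheorem7 (n : ℕ) (hn : 2 ≤ n) (hmod : n % 12 = 1 ∨ n % 12 = 9)
    (B : Finset (Finset (Fin n))) (hB : IsSteinerTripleSystem B) :
    ¬ ConformallyEquivalent (steinerCubic B) (simplicialPoly n) ∧
      ¬ ConformallyAssociative (steinerCubic B) :=
  mainTheorem7_general hB (hB.not_isProjectiveTripleSystem hn (by omega))
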